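/- Fix integers $1\le k\le n$. A fork-join queue with $n$ nodes has job arrival epochs $a^0\le a^1\le\cdots$ (almost surely) and service times $s_i^j\ge 0$ (of the sub-task of job $j$ at node $i$, $1\le i\le n$, $j\ge 0$), random variables on a common probability space. Each arriving job sends one sub-task to each node; each node has an unlimited buffer, serves first-come-first-served, is initially empty and executes all its sub-tasks, so that node $i$ completes the sub-task of job $0$ at $d_i^0=a^0+s_i^0$ and that of job $j\ge 1$ at $d_i^j=\max(a^j,d_i^{j-1})+s_i^j$; its sojourn time is $t_i^j=d_i^j-a^j$. The stable sojourn times $(t_1,\dots,t_n)$ are the limit in distribution of $(t_1^j,\dots,t_n^j)$ as $j\to\infty$, if it exists. In the non-purging $(n,k)$ fork-join queue a job is done as soon as $k$ of its $n$ sub-tasks are completed, so its stable sojourn time is the $k$-th smallest value $t_{(n,k)}$ of $t_1,\dots,t_n$; the basic $(n,n)$ fork-join queue is the case $k=n$. Suppose that the nodes are homogeneous: for every $m\le n$, any $m$ nodes (listed in increasing order) have the same joint law of service times jointly with the arrival process. No independence and no specific distribution of inter-arrival or service times is assumed. For $k\le i\le n$ let a basic $(i,i)$ fork-join queue be given that is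 equivalent to the $n$-node queue, i.e. has the same job arrival process and service times in distribution: for every $m\le i$, any $m$ of its nodes and any $m$ of the $n$ nodes have the same joint law of service times jointly with the arrival process. (If the nodes are independent of each other and of the arrivals, this just means the same law of the arrival process and the same law of the service times at each node.) Suppose that the stable sojourn times of these queues exist and that the expected sojourn times $\mathbb T_i=E[t_{(i,i)}]$ of the $(i,i)$ queues, $k\le i\le n$, are finite. Then the $n$-node queue has stable sojourn times, and the expected sojourn time $\mathbb{NT}_{n,k}=E[t_{(n,k)}]$ of the non-purging $(n,k)$ fork-join queue is finite and equals $$\mathbb{NT}_{n,k}=\sum_{i=k}^{n}W_i^{n,k}\,\mathbb T_i ,\qquad W_i^{n,k}=\sum_{j=k}^{i}\binom nj A_i^{n,j},$$ where $A_j^{n,j}=1$ and $A_i^{n,j}=-\sum_{l=1}^{i-j}\binom{n-i+l}{l}A_{i-l}^{n,j}$ for $j+1\le i\le n$. -/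

import Mathlib

open MeasureTheory ProbabilityTheory Filter
open scoped Topology

namespace ForkJoin

/-! ### Order statistics and the coefficients of the linear transformation -/

/-- The `k`-th order statistic (the `k`-th smallest coordinate, counted from `1`) of a vector
`x` of `n` real numbers. It is used for `1 ≤ k ≤ n` only; the value is `0` otherwise. -/
noncomputable def orderStat {n : ℕ} (k : ℕ) (x : Fin n → ℝ) : ℝ :=
  if h : 1 ≤ k ∧ k ≤ n then x (Tuple.sort x ⟨k - 1, by omega⟩) else 0

/-- The coefficients `A^{n,k}_i`, for `k ≤ i ≤ n`: `A^{n,k}_k = 1` and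
`A^{n,k}_i = - ∑_{j=1}^{i-k} (n-i+j choose j) A^{n,k}_{i-j}` for `k + 1 ≤ i ≤ n`.
The summation index below is `j - 1`. -/
def coeffA (n k i : ℕ) : ℤ :=
  if i ≤ k then (if i = k then 1 else 0)
  else -∑ j : Fin (i - k),
    ((n - i + (j.val + 1)).choose (j.val + 1) : ℤ) * coeffA n k (i - (j.val + 1))
termination_by i
decreasing_by omega

/-- The coefficients `W^{n,k}_i = ∑_{j=k}^{i} (n choose j) A^{n,j}_i`, for `k ≤ i ≤ n`. -/
def coeffW (n k i : ℕ) : ℤ :=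
  ∑ j ∈ Finset.Icc k i, (n.choose j : ℤ) * coeffA n j i

/-! ### Fork-join queues -/

/-- The primitives of a fork-join queue with `n` nodes on a probability space: the arrival epochs
of the jobs `0, 1, 2, …` and the service time of the sub-task of job `j` at node `i`. Inter-arrival
times and service times are nonnegative; nothing else is imposed on their joint distribution. -/
structure Queue {Ω : Type*} [MeasurableSpace Ω] (P : Measure Ω) (n : ℕ) where
  /-- arrival epoch of job `j` -/
  arrival : ℕ → Ω → ℝ
  /-- service time of the sub-task of job `j` at node `i` -/
  service : Fin n → ℕ → Ω → ℝ
  measurable_arrival : ∀ j, Measurable (arrival j)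
  measurable_service : ∀ i j, Measurable (service i j)
  arrival_mono : ∀ j, ∀ᵐ ω ∂P, arrival j ω ≤ arrival (j + 1) ω
  service_nonneg : ∀ i j, ∀ᵐ ω ∂P, 0 ≤ service i j ω

namespace Queue

variable {Ω : Type*} [MeasurableSpace Ω] {P : Measure Ω} {n : ℕ}

/-- The epoch at which node `i` completes the sub-task of job `j`. Every arriving job sends one
sub-task to each node; each node has an unlimited buffer, serves first-come-first-served, is
initially empty, and executes all its sub-tasks (non-purging). -/
noncomputable def completion (Q : Queue P n) (i : Fin n) : ℕ → Ω → ℝ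
  | 0, ω => Q.arrival 0 ω + Q.service i 0 ω
  | j + 1, ω => max (Q.arrival (j + 1) ω) (Q.completion i j ω) + Q.service i (j + 1) ω

/-- The sojourn time `t_i^j` of the sub-task of job `j` at node `i`. -/
noncomputable def sojourn (Q : Queue P n) (j : ℕ) (ω : Ω) (i : Fin n) : ℝ :=
  Q.completion i j ω - Q.arrival j ω

/-- `π` is the joint law of the stable sojourn times `(t_1, …, t_n)` of the sub-tasks of a job:
the vector `(t_1^j, …, t_n^j)` converges in distribution to `π` as `j → ∞`. -/
def IsStableLaw [IsProbabilityMeasure P] (Q : Queue P n)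
    (π : ProbabilityMeasure (Fin n → ℝ)) : Prop :=
  TendstoInDistribution Q.sojourn atTop id (fun _ => P) (π : Measure (Fin n → ℝ))

/-- The non-purging `(n,k)` fork-join queue with the primitives `Q`, in which a job is done as soon
as `k` of its `n` sub-tasks are completed, is stable and the expectation of the stable sojourn time
`t_{(n,k)}` of a job exists, is finite and equals `m`. For `k = n` this is the basic `(n,n)`
fork-join queue, in which a job is done when all its sub-tasks are completed. -/
def HasExpectedSojourn [IsProbabilityMeasure P] (Q : Queue P n) (k : ℕ) (m : ℝ) : Prop :=
  ∃ π : ProbabilityMeasure (Fin n → ℝ), Q.IsStableLaw π ∧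
    Integrable (orderStat k) (π : Measure (Fin n → ℝ)) ∧
    ∫ x, orderStat k x ∂(π : Measure (Fin n → ℝ)) = m

/-- The joint law of the arrival process and the service times of the nodes
`e 0 < e 1 < … < e (m - 1)`. -/
noncomputable def inputLaw (Q : Queue P n) {m : ℕ} (e : Fin m ↪o Fin n) :
    Measure ((ℕ → ℝ) × (Fin m → ℕ → ℝ)) :=
  P.map (fun ω => ((fun j => Q.arrival j ω), (fun l j => Q.service (e l) j ω)))

/-- Two fork-join queues, with possibly different numbers of nodes, are equivalent: they have the
same job arrival process and the same service times at the nodes, in distribution. As service times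
of different nodes may depend on each other, the comparison is made for any `m` nodes of the one
queue and any `m` nodes of the other (`m = 1` is the service time distribution of one node). -/
def Equivalent {Ω' : Type*} [MeasurableSpace Ω'] {P' : Measure Ω'} {n' : ℕ}
    (Q : Queue P n) (Q' : Queue P' n') : Prop :=
  ∀ (m : ℕ) (e : Fin m ↪o Fin n) (e' : Fin m ↪o Fin n'), Q.inputLaw e = Q'.inputLaw e'

/-- The nodes are homogeneous (interchangeable): for every `m`, any `m` of the nodes have the same
joint law of service times, jointly with the arrival process. -/
def Homogeneous (Q : Queue P n) : Prop :=
  ∀ (m : ℕ) (e e' : Fin m ↪o Fin n), Q.inputLaw e = Q.inputLaw e'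

/-- The law of the inputs when the service times are independent of the arrivals and independent
between nodes, with the same law `ν` of the sequence of service times at each node. -/
theorem inputLaw_of_indep [IsProbabilityMeasure P] (Q : Queue P n)
    (ν : Measure (ℕ → ℝ))
    (hAS : IndepFun (fun ω j => Q.arrival j ω) (fun ω i j => Q.service i j ω) P)
    (hS : iIndepFun (fun i ω j => Q.service i j ω) P)
    (hν : ∀ i, P.map (fun ω j => Q.service i j ω) = ν)
    {m : ℕ} (e : Fin m ↪o Fin n) :
    Q.inputLaw e = (P.map (fun ω j => Q.arrival j ω)).prod (Measure.pi (fun _ => ν)) := by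
  have hA : Measurable (fun ω j => Q.arrival j ω) := measurable_pi_lambda _ Q.measurable_arrival
  have hSm : ∀ i, Measurable (fun ω j => Q.service i j ω) :=
    fun i => measurable_pi_lambda _ (Q.measurable_service i)
  have hsel : Measurable (fun (s : Fin n → ℕ → ℝ) (l : Fin m) => s (e l)) := by fun_prop
  have h1 : IndepFun (fun ω j => Q.arrival j ω) (fun ω (l : Fin m) j => Q.service (e l) j ω) P :=
    hAS.comp measurable_id hsel
  have h2 : iIndepFun (fun (l : Fin m) ω j => Q.service (e l) j ω) P := hS.precomp e.injective
  have hSe : Measurable (fun ω (l : Fin m) j => Q.service (e l) j ω) :=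
    measurable_pi_lambda _ (fun l => hSm (e l))
  rw [indepFun_iff_map_prod_eq_prod_map_map hA.aemeasurable hSe.aemeasurable] at h1
  rw [iIndepFun_iff_map_fun_eq_pi_map (fun l => (hSm (e l)).aemeasurable)] at h2
  unfold inputLaw
  rw [h1, h2]
  simp only [hν]

/-- With nodes that are independent of each other and of the arrivals, equivalence just means the
same arrival process and the same service time distribution at each node. -/
theorem Equivalent.of_indep [IsProbabilityMeasure P] {Ω' : Type*} [MeasurableSpace Ω']
    {P' : Measure Ω'} [IsProbabilityMeasure P'] {n' : ℕ} (Q : Queue P n) (Q' : Queue P' n')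
    (ν : Measure (ℕ → ℝ))
    (hAS : IndepFun (fun ω j => Q.arrival j ω) (fun ω i j => Q.service i j ω) P)
    (hS : iIndepFun (fun i ω j => Q.service i j ω) P)
    (hν : ∀ i, P.map (fun ω j => Q.service i j ω) = ν)
    (hAS' : IndepFun (fun ω j => Q'.arrival j ω) (fun ω i j => Q'.service i j ω) P')
    (hS' : iIndepFun (fun i ω j => Q'.service i j ω) P')
    (hν' : ∀ i, P'.map (fun ω j => Q'.service i j ω) = ν)
    (hA : P.map (fun ω j => Q.arrival j ω) = P'.map (fun ω j => Q'.arrival j ω)) :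
    Q.Equivalent Q' := by
  intro m e e'
  rw [Q.inputLaw_of_indep ν hAS hS hν, Q'.inputLaw_of_indep ν hAS' hS' hν', hA]

end Queue

end ForkJoin

namespace ForkJoin

/-! ### Closed forms of the coefficients -/

/-! The `k`-th order statistic of a fixed vector is a linear combination of maxima of subvectors:
the sum over `i` of `(-1)^(i-k) * C(i-1,k-1)` times the sum of the maxima over all `i`-subsets
(`orderStat_eq_sum_maxOn`). This identity is integrated against the stable law of the `n` nodes.

At every finite job index, the sojourn times at the nodes in `S` are a fixed measurable function of
the arrivals and the service times at `S`. Hence they have the law of the equivalent queue with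
`S.card` nodes, and the limits agree too: the maximum over each `i`-subset has mean `T i`
(`Equivalent.integral_maxOn`). There are `C(n,i)` such subsets, and `coeffW_eq` identifies the
resulting coefficient with `W`. -/

theorem sum_Icc_add {M : Type*} [AddCommMonoid M] (f : ℕ → M) (k d : ℕ) :
    ∑ i ∈ Finset.Icc k (k + d), f i = ∑ t ∈ Finset.range (d + 1), f (k + t) := by
  rw [← Finset.Ico_add_one_right_eq_Icc, Finset.sum_Ico_eq_sum_range]
  congr 2
  omega

theorem alternating_sum_range_choose_of_le {a d : ℕ} (h : a ≤ d) :
    ∑ t ∈ Finset.range (d + 1), (-1 : ℤ) ^ t * (a.choose t : ℤ) = if a = 0 then 1 else 0 := by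
  rw [← Int.alternating_sum_range_choose]
  symm
  refine Finset.sum_subset (Finset.range_mono (by omega)) fun t _ ht => ?_
  rw [Nat.choose_eq_zero_of_lt (by simpa using ht)]
  simp

/-- The recursion says that the sum of `C(n-i+l,l) * A_{i-l}` over `0 ≤ l ≤ i-k` vanishes for `i >
k`. For the closed form this sum is a multiple of `(1-1)^d`. Writing `i = k+d`, `n = k+d+e` avoids
truncated subtraction; `e` is generalized because `n` stays fixed while `d` drops. -/
theorem coeffA_add (e k : ℕ) (d : ℕ) :
    coeffA (k + d + e) k (k + d) = (-1) ^ d * ((d + e).choose d : ℤ) := by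
  induction d using Nat.strong_induction_on generalizing e with
  | _ d ih =>
  rcases Nat.eq_zero_or_pos d with rfl | hd
  · rw [coeffA]; simp
  have hsum : ∑ l ∈ Finset.range (d + 1),
      ((e + l).choose l : ℤ) * ((-1) ^ (d - l) * ((d + e).choose (d - l) : ℤ)) = 0 := by
    have h0 := alternating_sum_range_choose_of_le (le_refl d)
    rw [if_neg hd.ne'] at h0
    rw [← mul_zero ((-1) ^ d * ((d + e).choose e : ℤ)), ← h0, Finset.mul_sum]
    refine Finset.sum_congr rfl fun l hl => ?_
    have hl : l ≤ d := by simpa [Nat.lt_succ_iff] using hl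
    have h1 : (d + e).choose (e + l) * (e + l).choose e = (d + e).choose e * d.choose l := by
      rw [Nat.choose_mul (by omega)]
      congr 2 <;> omega
    have h2 : (d + e).choose (d - l) = (d + e).choose (e + l) :=
      Nat.choose_symm_of_eq_add (by omega)
    have h3 : (e + l).choose l = (e + l).choose e := Nat.choose_symm_of_eq_add (by omega)
    have h4 : (-1 : ℤ) ^ (d - l) = (-1) ^ d * (-1) ^ l := by
      rw [← pow_add, show d + l = (d - l) + 2 * l by omega, pow_add, pow_mul]
      simp
    have h1' : ((d + e).choose (e + l) : ℤ) * (e + l).choose e = (d + e).choose e * d.choose l := by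
      exact_mod_cast h1
    rw [h2, h3, h4]
    linear_combination ((-1) ^ d * (-1) ^ l) * h1'
  -- The term `l = 0` is the claimed value; the others form the sum in the recursion.
  rw [Finset.sum_range_succ'] at hsum
  rw [coeffA, if_neg (by omega)]
  rw [show k + d - k = d by omega]
  rw [neg_eq_iff_add_eq_zero, ← hsum]
  congr 1
  · rw [← Fin.sum_univ_eq_sum_range
      (fun l => ((e + (l + 1)).choose (l + 1) : ℤ) *
        ((-1) ^ (d - (l + 1)) * ((d + e).choose (d - (l + 1)) : ℤ)))]
    refine Finset.sum_congr rfl fun j _ => ?_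
    have hj := j.isLt
    have := ih (d - (j.val + 1)) (by omega) (e + (j.val + 1))
    rw [show k + (d - (j.val + 1)) + (e + (j.val + 1)) = k + d + e by omega,
      show k + (d - (j.val + 1)) = k + d - (j.val + 1) by omega,
      show d - (j.val + 1) + (e + (j.val + 1)) = d + e by omega] at this
    rw [this, show k + d + e - (k + d) + (j.val + 1) = e + (j.val + 1) by omega]
  · simp

theorem coeffA_eq {n k i : ℕ} (hki : k ≤ i) (hin : i ≤ n) :
    coeffA n k i = (-1) ^ (i - k) * ((n - k).choose (i - k) : ℤ) := by
  have := coeffA_add (n - i) k (i - k)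
  rwa [show k + (i - k) + (n - i) = n by omega, show k + (i - k) = i by omega,
    show i - k + (n - i) = n - k by omega] at this

/-- Since `C(n,j) * C(n-j,i-j) = C(n,i) * C(i,j)`, what remains is a truncated alternating sum over
row `i` of Pascal's triangle, which is a signed entry of row `i-1`. -/
theorem coeffW_eq {n k i : ℕ} (hki : k + 1 ≤ i) (hin : i ≤ n) :
    coeffW n (k + 1) i = (-1) ^ (i - (k + 1)) * ((i - 1).choose k : ℤ) * (n.choose i : ℤ) := by
  obtain ⟨d, rfl⟩ := Nat.exists_eq_add_of_le hki
  have h := Int.alternating_sum_range_choose_eq_choose (n := k + d) (m := d)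
  unfold coeffW
  rw [sum_Icc_add, ← Finset.sum_range_reflect]
  rw [show k + 1 + d - (k + 1) = d by omega, show k + 1 + d - 1 = k + d by omega,
    Nat.choose_symm_add, ← h, Finset.sum_mul]
  refine Finset.sum_congr rfl fun t ht => ?_
  have ht : t ≤ d := by simpa [Nat.lt_succ_iff] using ht
  rw [coeffA_eq (by omega) hin]
  rw [show k + 1 + d - (k + 1 + (d + 1 - 1 - t)) = t by omega,
    show k + 1 + (d + 1 - 1 - t) = k + 1 + d - t by omega]
  have h1 : n.choose (k + 1 + d) * (k + 1 + d).choose (k + 1 + d - t)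
      = n.choose (k + 1 + d - t) * (n - (k + 1 + d - t)).choose t := by
    rw [Nat.choose_mul (by omega)]
    congr 2; omega
  rw [Nat.choose_symm (by omega)] at h1
  have h1' : (n.choose (k + 1 + d) : ℤ) * (k + 1 + d).choose t
      = n.choose (k + 1 + d - t) * (n - (k + 1 + d - t)).choose t := by exact_mod_cast h1
  rw [show k + d + 1 = k + 1 + d by omega]
  linear_combination (-(-1) ^ t) * h1'

/-! ### Order statistics as combinations of maxima of subvectors -/

theorem orderStat_eq {n k : ℕ} (hk : k < n) (x : Fin n → ℝ) :
    orderStat (k + 1) x = x (Tuple.sort x ⟨k, hk⟩) := by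
  rw [orderStat, dif_pos ⟨by omega, by omega⟩]
  rfl

theorem isGreatest_orderStat {n : ℕ} (x : Fin (n + 1) → ℝ) :
    IsGreatest (Set.range x) (orderStat (n + 1) x) := by
  rw [orderStat_eq (Nat.lt_succ_self n)]
  refine ⟨⟨_, rfl⟩, ?_⟩
  rintro _ ⟨j, rfl⟩
  have h : x j = (x ∘ Tuple.sort x) ((Tuple.sort x).symm j) := by simp
  rw [h]
  exact Tuple.monotone_sort x (Fin.le_last _)

/-- `S` is a set of ranks, carried to coordinates by the sorting permutation; by monotonicity the
top rank gives the maximum. Working with ranks makes ties harmless. -/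
theorem orderStat_comp_eq_of_isMax {n i : ℕ} (x : Fin n → ℝ) (S : Finset (Fin n))
    (hS : S.card = i + 1) {r : Fin n} (hr : r ∈ S) (hmax : ∀ s ∈ S, s ≤ r) :
    orderStat (i + 1)
      (fun l => x (((S.map (Tuple.sort x).toEmbedding).orderEmbOfFin (by simpa using hS)) l))
      = x (Tuple.sort x r) := by
  refine (isGreatest_orderStat _).unique ⟨?_, ?_⟩
  · have : Tuple.sort x r ∈ Set.range
        ((S.map (Tuple.sort x).toEmbedding).orderEmbOfFin (k := i + 1) (by simpa using hS)) := by
      rw [Finset.range_orderEmbOfFin]; simpa using hr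
    obtain ⟨l, hl⟩ := this
    exact ⟨l, by simp only [hl]⟩
  · rintro _ ⟨l, rfl⟩
    have := Finset.orderEmbOfFin_mem (S.map (Tuple.sort x).toEmbedding) (k := i + 1)
      (by simpa using hS) l
    obtain ⟨s, hs, hsl⟩ := Finset.mem_map.1 this
    simp only [← hsl]
    exact Tuple.monotone_sort x (hmax s hs)

/-- The largest coordinate of `x` with index in `S`, as the top order statistic of the subvector. -/
noncomputable def maxOn {n : ℕ} (S : Finset (Fin n)) (x : Fin n → ℝ) : ℝ :=
  orderStat S.card (fun l => x (S.orderEmbOfFin rfl l))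

theorem maxOn_eq {n i : ℕ} (S : Finset (Fin n)) (hS : S.card = i) (x : Fin n → ℝ) :
    maxOn S x = orderStat i (fun l => x (S.orderEmbOfFin hS l)) := by
  subst hS; rfl

theorem card_filter_max_eq {n i : ℕ} (r : Fin n) :
    (((Finset.univ : Finset (Fin n)).powersetCard (i + 1)).filter
      (fun S => r ∈ S ∧ ∀ s ∈ S, s ≤ r)).card = r.val.choose i := by
  rw [← Fin.card_Iio r, ← Finset.card_powersetCard]
  refine Finset.card_nbij' (fun S => S.erase r) (fun S => insert r S) ?_ ?_ ?_ ?_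
  · intro S hS
    simp only [Finset.coe_filter, Finset.mem_powersetCard, Set.mem_ofPred_eq] at hS
    simp only [Finset.mem_coe, Finset.mem_powersetCard]
    refine ⟨fun s hs => ?_, by rw [Finset.card_erase_of_mem hS.2.1]; omega⟩
    rw [Finset.mem_erase] at hs
    exact Finset.mem_Iio.2 (lt_of_le_of_ne (hS.2.2 s hs.2) hs.1)
  · intro S hS
    simp only [Finset.mem_coe, Finset.mem_powersetCard] at hS
    have hr : r ∉ S := fun h => lt_irrefl _ (Finset.mem_Iio.1 (hS.1 h))
    simp only [Finset.coe_filter, Finset.mem_powersetCard, Set.mem_ofPred_eq]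
    refine ⟨⟨Finset.subset_univ _, by rw [Finset.card_insert_of_notMem hr, hS.2]⟩,
      Finset.mem_insert_self _ _, fun s hs => ?_⟩
    rcases Finset.mem_insert.1 hs with rfl | h
    · exact le_rfl
    · exact (Finset.mem_Iio.1 (hS.1 h)).le
  · intro S hS
    simp only [Finset.coe_filter, Set.mem_ofPred_eq] at hS
    exact Finset.insert_erase hS.2.1
  · intro S hS
    simp only [Finset.mem_coe, Finset.mem_powersetCard] at hS
    exact Finset.erase_insert fun h => lt_irrefl _ (Finset.mem_Iio.1 (hS.1 h))

/-- After reindexing subsets by ranks, the value of rank `r` (from 0) is counted once for each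
`(i+1)`-set of ranks with top element `r`, which is `i` choices below `r`. -/
theorem sum_maxOn {n : ℕ} (i : ℕ) (x : Fin n → ℝ) :
    ∑ S ∈ (Finset.univ : Finset (Fin n)).powersetCard (i + 1), maxOn S x
      = ∑ r : Fin n, (r.val.choose i : ℝ) * x (Tuple.sort x r) := by
  calc ∑ S ∈ (Finset.univ : Finset (Fin n)).powersetCard (i + 1), maxOn S x
      = ∑ S ∈ (Finset.univ : Finset (Fin n)).powersetCard (i + 1),
          maxOn (S.map (Tuple.sort x).toEmbedding) x := by
        symm
        refine Finset.sum_nbij' (fun S => S.map (Tuple.sort x).toEmbedding)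
          (fun S => S.map (Tuple.sort x).symm.toEmbedding) ?_ ?_ ?_ ?_ ?_
        · intro S hS; simpa [Finset.mem_powersetCard] using hS
        · intro S hS; simpa [Finset.mem_powersetCard] using hS
        · intro S _; ext; simp
        · intro S _; ext; simp
        · intro S _; rfl
    _ = ∑ S ∈ (Finset.univ : Finset (Fin n)).powersetCard (i + 1), ∑ r : Fin n,
          if r ∈ S ∧ ∀ s ∈ S, s ≤ r then x (Tuple.sort x r) else 0 := by
        refine Finset.sum_congr rfl fun S hS => ?_
        have hc : S.card = i + 1 := (Finset.mem_powersetCard.1 hS).2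
        have hne : S.Nonempty := Finset.card_pos.1 (by omega)
        rw [Finset.sum_eq_single (S.max' hne)]
        · rw [if_pos ⟨S.max'_mem hne, fun s hs => S.le_max' s hs⟩,
            maxOn_eq _ (by simpa using hc) x]
          exact orderStat_comp_eq_of_isMax x S hc (S.max'_mem hne) fun s hs => S.le_max' s hs
        · intro r _ hr
          rw [if_neg]
          rintro ⟨h1, h2⟩
          exact hr (le_antisymm (S.le_max' r h1) (h2 _ (S.max'_mem hne)))
        · simp
    _ = _ := by
        rw [Finset.sum_comm]
        refine Finset.sum_congr rfl fun r _ => ?_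
        rw [← Finset.sum_filter, Finset.sum_const, card_filter_max_eq, nsmul_eq_mul]

/-- Every order statistic is a linear combination of maxima of subvectors. -/
theorem orderStat_eq_sum_maxOn {n k : ℕ} (hk : k < n) (x : Fin n → ℝ) :
    orderStat (k + 1) x = ∑ i ∈ Finset.Icc (k + 1) n,
      ((-1) ^ (i - (k + 1)) * ((i - 1).choose k : ℝ)) *
        ∑ S ∈ (Finset.univ : Finset (Fin n)).powersetCard i, maxOn S x := by
  have hn : k + 1 + (n - (k + 1)) = n := by omega
  -- Binomial inversion: these coefficients invert the triangular system given by `sum_maxOn`.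
  have key : ∀ r : Fin n, ∑ t ∈ Finset.range (n - (k + 1) + 1),
      ((-1) ^ t * ((k + t).choose k : ℝ)) * (r.val.choose (k + t) : ℝ)
        = if r = ⟨k, hk⟩ then 1 else 0 := by
    intro r
    by_cases hr : r.val < k
    · rw [if_neg (by rintro rfl; simp at hr)]
      refine Finset.sum_eq_zero fun t _ => ?_
      rw [Nat.choose_eq_zero_of_lt (show r.val < k + t by omega)]
      simp
    · have h0 := alternating_sum_range_choose_of_le
        (show r.val - k ≤ n - (k + 1) by have := r.isLt; omega)
      have h0' : ∑ t ∈ Finset.range (n - (k + 1) + 1), (-1 : ℝ) ^ t * ((r.val - k).choose t : ℝ)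
          = if r.val - k = 0 then 1 else 0 := by exact_mod_cast h0
      have h1 : ∀ t, ((-1) ^ t * ((k + t).choose k : ℝ)) * (r.val.choose (k + t) : ℝ)
          = (r.val.choose k : ℝ) * ((-1 : ℝ) ^ t * ((r.val - k).choose t : ℝ)) := by
        intro t
        have h2 : r.val.choose (k + t) * (k + t).choose k
            = r.val.choose k * (r.val - k).choose t := by
          rw [Nat.choose_mul (by omega)]
          congr 2; omega
        have h2' : (r.val.choose (k + t) : ℝ) * (k + t).choose k
            = r.val.choose k * (r.val - k).choose t := by exact_mod_cast h2
        linear_combination (-1) ^ t * h2'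
      simp only [h1]
      rw [← Finset.mul_sum, h0']
      by_cases hrk : r.val = k
      · rw [if_pos (by omega), if_pos (Fin.ext hrk), hrk]; simp
      · rw [if_neg (by omega), if_neg (fun h => hrk (by rw [h]))]; simp
  calc orderStat (k + 1) x
      = ∑ r : Fin n, (if r = ⟨k, hk⟩ then 1 else 0) * x (Tuple.sort x r) := by
        rw [orderStat_eq hk]; simp
    _ = ∑ t ∈ Finset.range (n - (k + 1) + 1), ((-1) ^ t * ((k + t).choose k : ℝ)) *
          ∑ S ∈ (Finset.univ : Finset (Fin n)).powersetCard (k + t + 1), maxOn S x := by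
        simp only [sum_maxOn, Finset.mul_sum]
        rw [Finset.sum_comm]
        refine Finset.sum_congr rfl fun r _ => ?_
        rw [← key r, Finset.sum_mul]
        refine Finset.sum_congr rfl fun t _ => ?_
        ring
    _ = _ := by
        -- Only the endpoint of the interval is rewritten, since `n` also occurs in types.
        rw [← congrArg (Finset.Icc (k + 1)) hn, sum_Icc_add]
        refine Finset.sum_congr rfl fun t _ => ?_
        rw [show k + 1 + t - (k + 1) = t by omega, show k + 1 + t - 1 = k + t by omega,
          show k + t + 1 = k + 1 + t by omega]

/-! ### Sojourn times as a function of the inputs -/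

theorem tendstoInDistribution_of_map_eq {ι E Ω₀ : Type*} {Ω₁ Ω₂ : ι → Type*}
    {m₁ : ∀ i, MeasurableSpace (Ω₁ i)} {m₂ : ∀ i, MeasurableSpace (Ω₂ i)}
    {μ : ∀ i, Measure (Ω₁ i)} [∀ i, IsProbabilityMeasure (μ i)]
    {ν : ∀ i, Measure (Ω₂ i)} [∀ i, IsProbabilityMeasure (ν i)]
    {m₀ : MeasurableSpace Ω₀} {μ₀ : Measure Ω₀} [IsProbabilityMeasure μ₀]
    {mE : MeasurableSpace E} [TopologicalSpace E] [OpensMeasurableSpace E]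
    {X : (i : ι) → Ω₁ i → E} {Y : (i : ι) → Ω₂ i → E} {Z : Ω₀ → E} {l : Filter ι}
    (h : TendstoInDistribution X l Z μ μ₀) (hY : ∀ i, AEMeasurable (Y i) (ν i))
    (hmap : ∀ i, (ν i).map (Y i) = (μ i).map (X i)) :
    TendstoInDistribution Y l Z ν μ₀ where
  forall_aemeasurable := hY
  aemeasurable_limit := h.aemeasurable_limit
  tendsto := by
    refine h.tendsto.congr fun i => ?_
    exact Subtype.ext (hmap i).symm

/-- The completion epochs at a node with arrival epochs `a` and service times `s`. -/
noncomputable def completionOf (a s : ℕ → ℝ) : ℕ → ℝ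
  | 0 => a 0 + s 0
  | j + 1 => max (a (j + 1)) (completionOf a s j) + s (j + 1)

/-- The sojourn times of job `j` as a function of the arrival epochs and service times. -/
noncomputable def sojournOf {m : ℕ} (j : ℕ) (p : (ℕ → ℝ) × (Fin m → ℕ → ℝ)) (l : Fin m) : ℝ :=
  completionOf p.1 (p.2 l) j - p.1 j

theorem measurable_sojournOf {m : ℕ} (j : ℕ) : Measurable (sojournOf (m := m) j) := by
  refine measurable_pi_lambda _ fun l => Measurable.sub ?_ (by fun_prop)
  induction j with
  | zero => simp only [completionOf]; fun_prop
  | succ j ih => simp only [completionOf]; fun_prop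

namespace Queue

variable {Ω : Type*} [MeasurableSpace Ω] {P : Measure Ω} {n : ℕ}

theorem completion_eq (Q : Queue P n) (i : Fin n) (j : ℕ) (ω : Ω) :
    Q.completion i j ω = completionOf (fun j => Q.arrival j ω) (fun j => Q.service i j ω) j := by
  induction j with
  | zero => rfl
  | succ j ih => simp only [completion, completionOf, ih]

theorem measurable_input (Q : Queue P n) {m : ℕ} (e : Fin m ↪o Fin n) :
    Measurable
      (fun ω => ((fun j => Q.arrival j ω), (fun (l : Fin m) j => Q.service (e l) j ω))) :=
  (measurable_pi_lambda _ Q.measurable_arrival).prodMk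
    (measurable_pi_lambda _ fun l => measurable_pi_lambda _ (Q.measurable_service (e l)))

theorem sojourn_comp_eq (Q : Queue P n) {m : ℕ} (e : Fin m ↪o Fin n) (j : ℕ) :
    (fun ω (l : Fin m) => Q.sojourn j ω (e l)) = sojournOf j ∘
      (fun ω => ((fun j => Q.arrival j ω), (fun (l : Fin m) j => Q.service (e l) j ω))) := by
  funext ω l
  simp only [sojourn, sojournOf, Function.comp, completion_eq]

theorem measurable_sojourn_comp (Q : Queue P n) {m : ℕ} (e : Fin m ↪o Fin n) (j : ℕ) :
    Measurable (fun ω (l : Fin m) => Q.sojourn j ω (e l)) := by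
  rw [sojourn_comp_eq]
  exact (measurable_sojournOf j).comp (Q.measurable_input e)

theorem map_sojourn_comp (Q : Queue P n) {m : ℕ} (e : Fin m ↪o Fin n) (j : ℕ) :
    P.map (fun ω (l : Fin m) => Q.sojourn j ω (e l)) = (Q.inputLaw e).map (sojournOf j) := by
  rw [sojourn_comp_eq, inputLaw, Measure.map_map (measurable_sojournOf j) (Q.measurable_input e)]

variable [IsProbabilityMeasure P] {Ω' : Type*} [MeasurableSpace Ω'] {P' : Measure Ω'}
  [IsProbabilityMeasure P'] {m : ℕ}

/-- The stable law of a queue equivalent to `Q` is the limit law of the sojourn times at any nodes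
of `Q` of the same number. -/
theorem Equivalent.tendstoInDistribution {B : Queue P' m} {Q : Queue P n} (h : B.Equivalent Q)
    (e : Fin m ↪o Fin n) {π : ProbabilityMeasure (Fin m → ℝ)} (hπ : B.IsStableLaw π) :
    TendstoInDistribution (fun j ω (l : Fin m) => Q.sojourn j ω (e l)) atTop id (fun _ => P)
      (π : Measure (Fin m → ℝ)) := by
  refine tendstoInDistribution_of_map_eq hπ
    (fun j => (Q.measurable_sojourn_comp e j).aemeasurable) fun j => ?_
  rw [map_sojourn_comp, ← h m (OrderIso.refl _).toOrderEmbedding e, ← map_sojourn_comp]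
  rfl

theorem Equivalent.isStableLaw {B : Queue P' n} {Q : Queue P n} (h : B.Equivalent Q)
    {π : ProbabilityMeasure (Fin n → ℝ)} (hπ : B.IsStableLaw π) : Q.IsStableLaw π :=
  h.tendstoInDistribution (OrderIso.refl _).toOrderEmbedding hπ

/-- The stable law of a queue equivalent to `Q` is the marginal of the stable law of `Q` at any
nodes of the same number. -/
theorem Equivalent.map_stableLaw {B : Queue P' m} {Q : Queue P n} (h : B.Equivalent Q)
    (e : Fin m ↪o Fin n) {π : ProbabilityMeasure (Fin m → ℝ)} (hπ : B.IsStableLaw π)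
    {ρ : ProbabilityMeasure (Fin n → ℝ)} (hρ : Q.IsStableLaw ρ) :
    (ρ : Measure (Fin n → ℝ)).map (fun x l => x (e l)) = (π : Measure (Fin m → ℝ)) := by
  -- Coordinate projection is continuous, so the marginals converge as well; limits in distribution
  -- are unique.
  have h1 := TendstoInDistribution.continuous_comp
    (g := fun (x : Fin n → ℝ) (l : Fin m) => x (e l)) (by fun_prop) hρ
  have h2 := tendstoInDistribution_unique _ h1 (h.tendstoInDistribution e hπ)
  simpa using h2

/-- The expected maximum of the stable sojourn times at the nodes in `S` is the expected sojourn
time of an equivalent basic queue with as many nodes. -/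
theorem Equivalent.integral_maxOn {B : Queue P' m} {Q : Queue P n} (h : B.Equivalent Q)
    {T : ℝ} (hT : B.HasExpectedSojourn m T) {ρ : ProbabilityMeasure (Fin n → ℝ)}
    (hρ : Q.IsStableLaw ρ) {S : Finset (Fin n)} (hS : S.card = m) :
    Integrable (maxOn S) (ρ : Measure (Fin n → ℝ)) ∧
      ∫ x, maxOn S x ∂(ρ : Measure (Fin n → ℝ)) = T := by
  obtain ⟨π, hπ, hint, rfl⟩ := hT
  have hmap := h.map_stableLaw (S.orderEmbOfFin hS) hπ hρ
  have hmeas : Measurable (fun (x : Fin n → ℝ) l => x (S.orderEmbOfFin hS l)) := by fun_prop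
  rw [← hmap] at hint ⊢
  have heq : maxOn S = orderStat m ∘ fun (x : Fin n → ℝ) l => x (S.orderEmbOfFin hS l) :=
    funext (maxOn_eq S hS)
  rw [integral_map hmeas.aemeasurable hint.aestronglyMeasurable, heq]
  exact ⟨hint.comp_measurable hmeas, rfl⟩

end Queue

end ForkJoin

theorem theorem4 {n k : ℕ} (hk : 1 ≤ k) (hkn : k ≤ n)
    {Ω : Type*} [MeasurableSpace Ω] {P : Measure Ω} [IsProbabilityMeasure P]
    (Q : ForkJoin.Queue P n) (hQ : Q.Homogeneous)
    {Ω' : ℕ → Type*} [∀ i, MeasurableSpace (Ω' i)] {P' : ∀ i, Measure (Ω' i)}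
    [∀ i, IsProbabilityMeasure (P' i)]
    (B : ∀ i, ForkJoin.Queue (P' i) i)
    (hB : ∀ i ∈ Finset.Icc k n, (B i).Equivalent Q)
    (T : ℕ → ℝ)
    (hT : ∀ i ∈ Finset.Icc k n, (B i).HasExpectedSojourn i (T i)) :
    Q.HasExpectedSojourn k (∑ i ∈ Finset.Icc k n, (ForkJoin.coeffW n k i : ℝ) * T i) := by
  have hn : n ∈ Finset.Icc k n := Finset.mem_Icc.2 ⟨hkn, le_rfl⟩
  -- The equivalent queue with `i = n` supplies the stable law of `Q`.
  obtain ⟨ρ, hρB, -, -⟩ := hT n hn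
  have hρ := (hB n hn).isStableLaw hρB
  obtain ⟨k, rfl⟩ := Nat.exists_eq_add_of_le' hk
  have hmax : ∀ i ∈ Finset.Icc (k + 1) n,
      ∀ S ∈ (Finset.univ : Finset (Fin n)).powersetCard i,
        Integrable (ForkJoin.maxOn S) (ρ : Measure (Fin n → ℝ)) ∧
          ∫ x, ForkJoin.maxOn S x ∂(ρ : Measure (Fin n → ℝ)) = T i :=
    fun i hi S hS => (hB i hi).integral_maxOn (hT i hi) hρ (Finset.mem_powersetCard.1 hS).2
  have hsum : ∀ i ∈ Finset.Icc (k + 1) n, Integrable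
      (fun x => ((-1) ^ (i - (k + 1)) * ((i - 1).choose k : ℝ)) *
        ∑ S ∈ (Finset.univ : Finset (Fin n)).powersetCard i, ForkJoin.maxOn S x)
      (ρ : Measure (Fin n → ℝ)) :=
    fun i hi => (integrable_finsetSum _ fun S hS => (hmax i hi S hS).1).const_mul _
  have heq := funext (ForkJoin.orderStat_eq_sum_maxOn (show k < n from hkn))
  refine ⟨ρ, hρ, ?_, ?_⟩ <;> rw [heq]
  · exact integrable_finsetSum _ hsum
  · rw [integral_finsetSum _ hsum]
    refine Finset.sum_congr rfl fun i hi => ?_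
    rw [integral_const_mul, integral_finsetSum _ fun S hS => (hmax i hi S hS).1,
      Finset.sum_congr rfl fun S hS => (hmax i hi S hS).2,
      ForkJoin.coeffW_eq (Finset.mem_Icc.1 hi).1 (Finset.mem_Icc.1 hi).2]
    simp only [Finset.sum_const, Finset.card_powersetCard, Finset.card_univ, Fintype.card_fin,
      nsmul_eq_mul]
    push_cast
    ring
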